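/- Let $K$ be a field of characteristic $0$, let $n\ge 2$, and let $\Gamma\subset\mathbb P^n_K$ be a finite set of ($K$-rational) points, not all contained in a hyperplane. Let $d(\Gamma)=|\Gamma|-\mathrm{hyp}(\Gamma)$, where $\mathrm{hyp}(\Gamma)$ is the maximum number of points of $\Gamma$ contained in a hyperplane. Let $R=K[x_0,\dots,x_n]$ with its standard grading, and let $I=I(\Gamma)\subset R$ be the ideal generated by the homogeneous polynomials vanishing at all points of $\Gamma$. Let $F_\bullet$ be a graded minimal free resolution of $R/I$. Then $F_n$ is its last nonzero module, and, writing $F_n=\bigoplus_i R(-a_i)$ and letting $A_n=\min_i\{a_i-n\}$ be the minimum socle degree of $R/I$, one has $$d(\Gamma)\ \ge\ A_n .$$ -/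

import Mathlib

open scoped LinearAlgebra.Projectivization

/-- `p` lies in the degree `e` part of the polynomial ring, standard graded, with the degree `e` an
arbitrary integer (the parts of negative degree are zero). -/
def IsHomogeneousOfDegree {K : Type*} [Field K] {σ : Type*} (p : MvPolynomial σ K) (e : ℤ) :
    Prop :=
  p = 0 ∨ ∃ k : ℕ, (k : ℤ) = e ∧ p.IsHomogeneous k

/-- `v` lies in the degree `e` part of the graded free module `⨁ₖ R(-aₖ)`, where
`R(-a)_e = R_{e-a}`. -/
def IsHomogeneousVec {K : Type*} [Field K] {σ : Type*} {r : ℕ} (a : Fin r → ℤ)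
    (v : Fin r → MvPolynomial σ K) (e : ℤ) : Prop :=
  ∀ k, IsHomogeneousOfDegree (v k) (e - a k)

/-- A graded minimal free resolution `⋯ → F₂ → F₁ → F₀ → R/I → 0` of `R/I`, where `R` is a
polynomial ring over a field and `Fᵢ = ⨁ₖ R(-shift i k)` has finite rank. No bound on the length is
imposed: `Fᵢ` is zero exactly when `rank i = 0`. -/
structure MinimalGradedFreeResolution {K : Type*} [Field K] {σ : Type*}
    (I : Ideal (MvPolynomial σ K)) where
  /-- the rank of `Fᵢ` -/
  rank : ℕ → ℕ
  /-- the shifts of `Fᵢ` -/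
  shift : (i : ℕ) → Fin (rank i) → ℤ
  /-- the differential `Fᵢ₊₁ → Fᵢ` -/
  d : (i : ℕ) →
    (Fin (rank (i + 1)) → MvPolynomial σ K) →ₗ[MvPolynomial σ K] (Fin (rank i) → MvPolynomial σ K)
  /-- the augmentation `F₀ → R/I` -/
  aug : (Fin (rank 0) → MvPolynomial σ K) →ₗ[MvPolynomial σ K] (MvPolynomial σ K ⧸ I)
  /-- the differentials preserve degrees -/
  d_graded : ∀ i e v, IsHomogeneousVec (shift (i + 1)) v e → IsHomogeneousVec (shift i) (d i v) e
  /-- the augmentation preserves degrees, `(R/I)_e` being the image of `R_e` -/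
  aug_graded : ∀ e v, IsHomogeneousVec (shift 0) v e →
    ∃ p : MvPolynomial σ K, IsHomogeneousOfDegree p e ∧ aug v = Ideal.Quotient.mk I p
  aug_surjective : Function.Surjective aug
  exact_zero : Function.Exact (d 0) aug
  exact_succ : ∀ i, Function.Exact (d (i + 1)) (d i)
  /-- minimality: the image of `Fᵢ₊₁` lies in `𝔪 Fᵢ`, where `𝔪` is generated by the variables -/
  minimal : ∀ i v k, d i v k ∈ Ideal.span (Set.range (MvPolynomial.X : σ → MvPolynomial σ K))

section

variable {K : Type*} [Field K] {n : ℕ}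

/-- The homogeneous ideal `I(Γ)` of a set of points of `ℙⁿ`, generated by the homogeneous
polynomials that vanish at every point of `Γ` (for a homogeneous polynomial, vanishing at a point
does not depend on the representative). -/
noncomputable def pointsIdeal (Γ : Finset (ℙ K (Fin (n + 1) → K))) : Ideal (MvPolynomial (Fin (n + 1)) K) :=
  Ideal.span {f | (∃ k : ℕ, f.IsHomogeneous k) ∧ ∀ P ∈ Γ, MvPolynomial.eval P.rep f = 0}

/-- The points of `Γ` on the hyperplane of equation `φ = 0`. -/
def onHyperplane (Γ : Finset (ℙ K (Fin (n + 1) → K))) (φ : Module.Dual K (Fin (n + 1) → K)) :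
    Set (ℙ K (Fin (n + 1) → K)) :=
  {P | P ∈ Γ ∧ φ P.rep = 0}

/-- The points of `Γ` do not all lie on one hyperplane. -/
def IsNondegenerate (Γ : Finset (ℙ K (Fin (n + 1) → K))) : Prop :=
  ∀ φ : Module.Dual K (Fin (n + 1) → K), φ ≠ 0 → ∃ P ∈ Γ, φ P.rep ≠ 0

/-- The maximum number of points of `Γ` on a hyperplane. -/
noncomputable def hyp (Γ : Finset (ℙ K (Fin (n + 1) → K))) : ℕ :=
  sSup {k | ∃ φ : Module.Dual K (Fin (n + 1) → K), φ ≠ 0 ∧ k = (onHyperplane Γ φ).ncard}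

/-- The minimum distance `d(Γ) = |Γ| - hyp(Γ)`. -/
noncomputable def minDist (Γ : Finset (ℙ K (Fin (n + 1) → K))) : ℤ :=
  (Γ.card : ℤ) - (hyp Γ : ℤ)

/-- The supremum in the definition of `hyp` is attained and is an upper bound. -/
theorem hyp_isGreatest (Γ : Finset (ℙ K (Fin (n + 1) → K))) :
    IsGreatest {k | ∃ φ : Module.Dual K (Fin (n + 1) → K),
      φ ≠ 0 ∧ k = (onHyperplane Γ φ).ncard} (hyp Γ) := by
  have hb : BddAbove {k | ∃ φ : Module.Dual K (Fin (n + 1) → K),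
      φ ≠ 0 ∧ k = (onHyperplane Γ φ).ncard} := by
    refine ⟨Γ.card, ?_⟩
    rintro k ⟨φ, -, rfl⟩
    rw [← Set.ncard_coe_finset Γ]
    exact Set.ncard_le_ncard (fun P hP => hP.1) Γ.finite_toSet
  refine ⟨Nat.sSup_mem ?_ hb, fun k hk => le_csSup hb hk⟩
  refine ⟨_, LinearMap.proj 0, fun h => ?_, rfl⟩
  have := LinearMap.congr_fun h (fun _ => (1 : K))
  simp at this

end

/-! Write `R` for the polynomial ring, `I` for the ideal of Γ and 𝔪 for the ideal of the variables.
Since `K` is infinite, some linear form ℓ vanishes at no point of Γ and involves `X 0`. Then ℓ is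
regular on `R/I`, and ℓ, X₁, …, Xₙ is a regular sequence on `R` generating 𝔪.

A socle element of `R/(I + (ℓ))` of degree e forces a generator of `Fₙ` of degree e + n. With Jₖ
generated by the first k terms of the sequence, the connecting maps of 0 → R/Jₖ(-1) → R/Jₖ → R/Jₖ₊₁
→ 0 carry the element up, one homological and one internal degree at a time, from Tor₀(R/I, R/J₁) to
Torₙ(R/I, R/𝔪), which by minimality is `Fₙ/𝔪Fₙ` (`exists_socle_representative`, `exists_shift_eq`).
The same sequences make Tor vanish above degree n, so `Fᵢ` = 0 for i > n (`mem_boundaries_of_d_mem`,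
`rank_eq_zero`).

The socle element is a separator of least degree for a point P off a hyperplane containing `hyp Γ`
points. Modulo I, every linear form multiplies it as a scalar multiple of ℓ does, and minimality
keeps it out of I + (ℓ). The equation of the hyperplane times one linear form through each other
point off it is a separator of P of degree d(Γ), which bounds e. -/

/-! ### Homogeneous components of polynomials and of vectors with shifts. -/

section Graded

variable {K : Type*} [Field K] {σ : Type*}

/-- The component of integer degree `e` of a polynomial. -/
noncomputable def intComponent (e : ℤ) : MvPolynomial σ K →ₗ[K] MvPolynomial σ K :=
  if 0 ≤ e then MvPolynomial.homogeneousComponent e.toNat else 0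

theorem intComponent_isHomogeneous (e : ℤ) (p : MvPolynomial σ K) :
    IsHomogeneousOfDegree (intComponent e p) e := by
  unfold intComponent
  split_ifs with h
  · exact Or.inr ⟨e.toNat, Int.toNat_of_nonneg h, MvPolynomial.homogeneousComponent_isHomogeneous _ _⟩
  · exact Or.inl rfl

theorem intComponent_natCast (k : ℕ) (p : MvPolynomial σ K) :
    intComponent (k : ℤ) p = MvPolynomial.homogeneousComponent k p := by
  simp [intComponent]

theorem intComponent_of_isHomogeneous {p : MvPolynomial σ K} {e' : ℤ}
    (hp : IsHomogeneousOfDegree p e') (e : ℤ) :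
    intComponent e p = if e = e' then p else 0 := by
  rcases hp with rfl | ⟨k, rfl, hk⟩
  · simp
  · unfold intComponent
    split_ifs with h1 h2 h2
    · subst h2
      simpa using MvPolynomial.homogeneousComponent_eq_self hk
    · rw [MvPolynomial.homogeneousComponent_of_mem hk, if_neg]
      omega
    · omega
    · rfl

theorem intComponent_mem {J : Ideal (MvPolynomial σ K)}
    (hJ : ∀ p ∈ J, ∀ k, MvPolynomial.homogeneousComponent k p ∈ J)
    {p : MvPolynomial σ K} (hp : p ∈ J) (e : ℤ) : intComponent e p ∈ J := by
  unfold intComponent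
  split_ifs
  · exact hJ p hp _
  · exact J.zero_mem

theorem homogeneous_induction {P : MvPolynomial σ K → Prop}
    (hadd : ∀ p q, P p → P q → P (p + q))
    (hhom : ∀ p (k : ℕ), p.IsHomogeneous k → P p) (p : MvPolynomial σ K) : P p := by
  rw [← MvPolynomial.sum_homogeneousComponent p]
  exact Finset.sum_induction _ P hadd (hhom 0 0 (MvPolynomial.isHomogeneous_zero _ _ _))
    fun i _ => hhom _ i (MvPolynomial.homogeneousComponent_isHomogeneous _ _)

theorem intComponent_mul {y : MvPolynomial σ K} (hy : y.IsHomogeneous 1) (e : ℤ)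
    (p : MvPolynomial σ K) : intComponent (e + 1) (y * p) = y * intComponent e p := by
  induction p using homogeneous_induction with
  | hadd p q hp hq => rw [mul_add, map_add, map_add, hp, hq, mul_add]
  | hhom p k hk =>
    have h1 : IsHomogeneousOfDegree (y * p) ((k : ℤ) + 1) :=
      Or.inr ⟨1 + k, by push_cast; ring, hy.mul hk⟩
    rw [intComponent_of_isHomogeneous h1, intComponent_of_isHomogeneous (Or.inr ⟨k, rfl, hk⟩)]
    simp

theorem span_component_mem {S : Set (MvPolynomial σ K)}
    (hS : ∀ f ∈ S, ∃ k : ℕ, f.IsHomogeneous k) :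
    ∀ p ∈ Ideal.span S, ∀ k, MvPolynomial.homogeneousComponent k p ∈ Ideal.span S := by
  let _ := MvPolynomial.gradedAlgebra (σ := σ) (R := K)
  intro p hp k
  exact MvPolynomial.homogeneousComponent_mem_of_mem
    (Ideal.homogeneous_span _ _ fun f hf => (hS f hf)) hp k

/-- The component of degree `e` of an element of `⨁ₖ R(-aₖ)`. -/
noncomputable def vecComponent {r : ℕ} (a : Fin r → ℤ) (e : ℤ) :
    (Fin r → MvPolynomial σ K) →ₗ[K] (Fin r → MvPolynomial σ K) :=
  LinearMap.pi fun k => intComponent (e - a k) ∘ₗ LinearMap.proj k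

theorem vecComponent_apply {r : ℕ} (a : Fin r → ℤ) (e : ℤ) (v : Fin r → MvPolynomial σ K)
    (k : Fin r) : vecComponent a e v k = intComponent (e - a k) (v k) := rfl

theorem vecComponent_isHomogeneous {r : ℕ} (a : Fin r → ℤ) (e : ℤ)
    (v : Fin r → MvPolynomial σ K) : IsHomogeneousVec a (vecComponent a e v) e :=
  fun _ => intComponent_isHomogeneous _ _

theorem vecComponent_of_isHomogeneous {r : ℕ} {a : Fin r → ℤ} {v : Fin r → MvPolynomial σ K}
    {e' : ℤ} (hv : IsHomogeneousVec a v e') (e : ℤ) :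
    vecComponent a e v = if e = e' then v else 0 := by
  ext1 k
  rw [vecComponent_apply, intComponent_of_isHomogeneous (hv k)]
  simp only [sub_left_inj]
  split_ifs <;> rfl

theorem vecComponent_smul {r : ℕ} (a : Fin r → ℤ) (e : ℤ) {y : MvPolynomial σ K}
    (hy : y.IsHomogeneous 1) (v : Fin r → MvPolynomial σ K) :
    vecComponent a (e + 1) (y • v) = y • vecComponent a e v := by
  ext1 k
  simp only [vecComponent_apply, Pi.smul_apply, smul_eq_mul]
  rw [← intComponent_mul hy, sub_add_eq_add_sub]

theorem vec_homogeneous_induction {r : ℕ} (a : Fin r → ℤ)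
    {P : (Fin r → MvPolynomial σ K) → Prop} (hadd : ∀ v w, P v → P w → P (v + w))
    (hhom : ∀ v e, IsHomogeneousVec a v e → P v) (v : Fin r → MvPolynomial σ K) : P v := by
  rw [← Finset.univ_sum_single v]
  refine Finset.sum_induction _ P hadd (hhom 0 0 fun k => Or.inl rfl) fun k _ => ?_
  induction v k using homogeneous_induction with
  | hadd p q hp hq => rw [Pi.single_add]; exact hadd _ _ hp hq
  | hhom p i hi =>
    refine hhom _ (i + a k) fun j => ?_
    by_cases h : j = k
    · subst h
      rw [Pi.single_eq_same]
      exact Or.inr ⟨i, by ring, hi⟩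
    · rw [Pi.single_eq_of_ne h]
      exact Or.inl rfl

/-- The submodule `J Rʳ` of `Rʳ`. -/
def vecIdeal {R : Type*} [CommRing R] (J : Ideal R) (r : ℕ) : Submodule R (Fin r → R) :=
  Submodule.pi Set.univ fun _ => J

theorem mem_vecIdeal {R : Type*} [CommRing R] {J : Ideal R} {r : ℕ} {v : Fin r → R} :
    v ∈ vecIdeal J r ↔ ∀ k, v k ∈ J := by
  simp [vecIdeal, Submodule.mem_pi]

theorem map_mem_vecIdeal {R : Type*} [CommRing R] {J : Ideal R} {r s : ℕ}
    (f : (Fin r → R) →ₗ[R] (Fin s → R)) {v : Fin r → R} (hv : v ∈ vecIdeal J r) :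
    f v ∈ vecIdeal J s := by
  rw [mem_vecIdeal] at hv ⊢
  intro k
  rw [LinearMap.pi_apply_eq_sum_univ f v, Finset.sum_apply]
  exact J.sum_mem fun i _ => J.mul_mem_right _ (hv i)

theorem vecComponent_mem {J : Ideal (MvPolynomial σ K)}
    (hJ : ∀ p ∈ J, ∀ k, MvPolynomial.homogeneousComponent k p ∈ J) {r : ℕ} (a : Fin r → ℤ)
    (e : ℤ) {v : Fin r → MvPolynomial σ K} (hv : v ∈ vecIdeal J r) :
    vecComponent a e v ∈ vecIdeal J r :=
  mem_vecIdeal.2 fun k => intComponent_mem hJ (mem_vecIdeal.1 hv k) _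

end Graded

/-! ### Ideals generated by initial segments of a sequence. -/

section RegularSequence

variable {R : Type*} [CommRing R]

/-- The ideal generated by the first `k` terms of a sequence. -/
def initialIdeal (y : ℕ → R) (k : ℕ) : Ideal R := Ideal.span (y '' Set.Iio k)

theorem initialIdeal_zero (y : ℕ → R) : initialIdeal y 0 = ⊥ := by
  simp [initialIdeal]

theorem initialIdeal_mono (y : ℕ → R) {k l : ℕ} (h : k ≤ l) :
    initialIdeal y k ≤ initialIdeal y l :=
  Ideal.span_mono (Set.image_mono (Set.Iio_subset_Iio h))

theorem mem_initialIdeal (y : ℕ → R) {i k : ℕ} (h : i < k) : y i ∈ initialIdeal y k :=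
  Ideal.subset_span ⟨i, h, rfl⟩

theorem exists_of_mem_initialIdeal_succ {y : ℕ → R} {k : ℕ} {f : R}
    (hf : f ∈ initialIdeal y (k + 1)) : ∃ u ∈ initialIdeal y k, ∃ g, f = u + y k * g := by
  have h : y '' Set.Iio (k + 1) = insert (y k) (y '' Set.Iio k) := by
    rw [← Set.image_insert_eq]
    congr 1
    ext i
    simp only [Set.mem_Iio, Set.mem_insert_iff]
    omega
  rw [initialIdeal, h, Ideal.mem_span_insert] at hf
  obtain ⟨g, u, hu, rfl⟩ := hf
  exact ⟨u, hu, g, by ring⟩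

theorem exists_of_mem_vecIdeal_succ {y : ℕ → R} {k r : ℕ} {v : Fin r → R}
    (hv : v ∈ vecIdeal (initialIdeal y (k + 1)) r) :
    ∃ u ∈ vecIdeal (initialIdeal y k) r, ∃ w, v = u + y k • w := by
  choose u hu g hg using fun j => exists_of_mem_initialIdeal_succ (mem_vecIdeal.1 hv j)
  exact ⟨u, mem_vecIdeal.2 hu, g, funext hg⟩

theorem smul_mem_vecIdeal (y : ℕ → R) {i k r : ℕ} (h : i < k) (v : Fin r → R) :
    y i • v ∈ vecIdeal (initialIdeal y k) r :=
  mem_vecIdeal.2 fun j => (initialIdeal y k).mul_mem_right (v j) (mem_initialIdeal y h)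

theorem vecIdeal_initialIdeal_mono (y : ℕ → R) {k l : ℕ} (r : ℕ) (h : k ≤ l) :
    vecIdeal (initialIdeal y k) r ≤ vecIdeal (initialIdeal y l) r :=
  fun _ hv => mem_vecIdeal.2 fun j => initialIdeal_mono y h (mem_vecIdeal.1 hv j)

end RegularSequence

/-! ### Homology of the resolution modulo a regular sequence. -/

namespace MinimalGradedFreeResolution

variable {K : Type*} [Field K] {σ : Type*} {I : Ideal (MvPolynomial σ K)}
  (F : MinimalGradedFreeResolution I)

theorem d_vecComponent (i : ℕ) (e : ℤ) (v : Fin (F.rank (i + 1)) → MvPolynomial σ K) :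
    F.d i (vecComponent (F.shift (i + 1)) e v) = vecComponent (F.shift i) e (F.d i v) := by
  induction v using vec_homogeneous_induction (F.shift (i + 1)) with
  | hadd v w hv hw => simp only [map_add, hv, hw]
  | hhom v e' h =>
    rw [vecComponent_of_isHomogeneous h, vecComponent_of_isHomogeneous (F.d_graded i e' v h)]
    split_ifs <;> simp

/-- One lift `p` serves all degrees at once, which stands in for a grading on `R/I`: the property is
additive in `v`, and `aug_graded` gives it for homogeneous `v`. -/
theorem exists_aug_vecComponent (v : Fin (F.rank 0) → MvPolynomial σ K) :
    ∃ p : MvPolynomial σ K, ∀ e, F.aug v = Ideal.Quotient.mk I p ∧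
      F.aug (vecComponent (F.shift 0) e v) = Ideal.Quotient.mk I (intComponent e p) := by
  induction v using vec_homogeneous_induction (F.shift 0) with
  | hadd v w hv hw =>
    obtain ⟨p, hp⟩ := hv
    obtain ⟨q, hq⟩ := hw
    refine ⟨p + q, fun e => ?_⟩
    simp only [map_add, (hp e).1, (hq e).1, (hp e).2, (hq e).2, and_self]
  | hhom v e' h =>
    obtain ⟨p, hp, hvp⟩ := F.aug_graded e' v h
    refine ⟨p, fun e => ⟨hvp, ?_⟩⟩
    rw [vecComponent_of_isHomogeneous h, intComponent_of_isHomogeneous hp]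
    split_ifs <;> simp [hvp]

theorem exists_isHomogeneousVec_aug_eq
    (hI : ∀ p ∈ I, ∀ k, MvPolynomial.homogeneousComponent k p ∈ I)
    {f : MvPolynomial σ K} {e : ℤ} (hf : IsHomogeneousOfDegree f e) :
    ∃ v, IsHomogeneousVec (F.shift 0) v e ∧ F.aug v = Ideal.Quotient.mk I f := by
  obtain ⟨v, hv⟩ := F.aug_surjective (Ideal.Quotient.mk I f)
  obtain ⟨p, hp⟩ := F.exists_aug_vecComponent v
  refine ⟨_, vecComponent_isHomogeneous _ e v, ?_⟩
  have h : p - f ∈ I := Ideal.Quotient.eq.1 ((hp e).1.symm.trans hv)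
  have h' := intComponent_mem hI h e
  rw [map_sub, intComponent_of_isHomogeneous hf, if_pos rfl] at h'
  exact (hp e).2.trans (Ideal.Quotient.eq.2 h')

theorem d_d (i : ℕ) (v : Fin (F.rank (i + 2)) → MvPolynomial σ K) : F.d i (F.d (i + 1) v) = 0 :=
  (F.exact_succ i _).2 ⟨v, rfl⟩

theorem exists_d_eq {i : ℕ} {v : Fin (F.rank (i + 1)) → MvPolynomial σ K} (hv : F.d i v = 0) :
    ∃ w, F.d (i + 1) w = v :=
  (F.exact_succ i _).1 hv

theorem aug_smul (y f : MvPolynomial σ K) (v : Fin (F.rank 0) → MvPolynomial σ K)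
    (hv : F.aug v = Ideal.Quotient.mk I f) : F.aug (y • v) = Ideal.Quotient.mk I (y * f) := by
  rw [map_smul, hv]
  rfl

/-- The boundaries of `F ⊗ R/(y₀, …, yₖ₋₁)` in degree `i`, as a submodule of `Fᵢ`. -/
noncomputable def boundaries (y : ℕ → MvPolynomial σ K) (k i : ℕ) :
    Submodule (MvPolynomial σ K) (Fin (F.rank i) → MvPolynomial σ K) :=
  LinearMap.range (F.d i) ⊔ vecIdeal (initialIdeal y k) (F.rank i)

variable {F}

theorem mem_boundaries {y : ℕ → MvPolynomial σ K} {k i : ℕ}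
    {v : Fin (F.rank i) → MvPolynomial σ K} :
    v ∈ F.boundaries y k i ↔
      ∃ p, ∃ q ∈ vecIdeal (initialIdeal y k) (F.rank i), v = F.d i p + q := by
  simp only [boundaries, Submodule.mem_sup, LinearMap.mem_range, exists_exists_eq_and]
  simp only [eq_comm]

variable (F) {n : ℕ} {y : ℕ → MvPolynomial σ K}

/-- If `y₀` is regular on `R/I` and `y₀, …, yₙ` is regular on `R`, then `F ⊗ R/(y₀, …, yₖ)` has no
homology in degrees above `k`. -/
theorem mem_boundaries_of_d_mem
    (hreg : ∀ k ≤ n, ∀ f, y k * f ∈ initialIdeal y k → f ∈ initialIdeal y k)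
    (hI : ∀ f, y 0 * f ∈ I → f ∈ I) {k : ℕ} (hk : k ≤ n) :
    ∀ i, k ≤ i → ∀ v : Fin (F.rank (i + 1)) → MvPolynomial σ K,
      F.d i v ∈ vecIdeal (initialIdeal y (k + 1)) (F.rank i) →
        v ∈ F.boundaries y (k + 1) (i + 1) := by
  have hvec : ∀ k ≤ n, ∀ {r : ℕ} (v : Fin r → MvPolynomial σ K),
      y k • v ∈ vecIdeal (initialIdeal y k) r → v ∈ vecIdeal (initialIdeal y k) r :=
    fun k hk r v hv => mem_vecIdeal.2 fun j => hreg k hk _ (mem_vecIdeal.1 hv j)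
  induction k with
  | zero =>
    intro i _ v hv
    obtain ⟨u, hu, w, hw⟩ := exists_of_mem_vecIdeal_succ hv
    have hu0 : u = 0 := by
      ext1 j
      simpa [initialIdeal_zero] using mem_vecIdeal.1 hu j
    rw [hu0, zero_add] at hw
    -- Here `d v = y₀ w`, and y₀ can be cancelled: in `R/I` after applying the augmentation if `i =
    -- 0`, and in a free module after applying `d` otherwise. So `w` lies in the kernel of the next
    -- map.
    obtain ⟨p, rfl⟩ : ∃ p, F.d i p = w := by
      cases i with
      | zero =>
        refine (F.exact_zero w).1 ?_
        obtain ⟨f, hf⟩ := Ideal.Quotient.mk_surjective (F.aug w)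
        have h1 : F.aug (y 0 • w) = 0 := by
          rw [← hw]
          exact (F.exact_zero _).2 ⟨v, rfl⟩
        rw [F.aug_smul _ f w hf.symm, Ideal.Quotient.eq_zero_iff_mem] at h1
        rw [← hf, Ideal.Quotient.eq_zero_iff_mem]
        exact hI f h1
      | succ i =>
        refine F.exists_d_eq ?_
        have h1 : y 0 • F.d i w = 0 := by rw [← map_smul, ← hw, F.d_d]
        have h2 := hvec 0 hk (F.d i w) (by rw [h1]; exact Submodule.zero_mem _)
        ext1 j
        simpa [initialIdeal_zero] using mem_vecIdeal.1 h2 j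
    obtain ⟨q, hq⟩ := F.exists_d_eq (v := v - y 0 • p) (by rw [map_sub, map_smul, hw, sub_self])
    exact mem_boundaries.2 ⟨q, y 0 • p, smul_mem_vecIdeal y one_pos p, by rw [hq]; abel⟩
  | succ k ih =>
    intro i hi v hv
    obtain ⟨i, rfl⟩ : ∃ j, i = j + 1 := ⟨i - 1, by omega⟩
    obtain ⟨u, hu, w, hw⟩ := exists_of_mem_vecIdeal_succ hv
    -- Applying `d` to `d v = u + yₖ₊₁ w` and cancelling yₖ₊₁ makes `w` a cycle modulo the shorter
    -- ideal, hence a boundary `d p + q`. Then `v - yₖ₊₁ p` is also such a cycle, one degree higher,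
    -- and the induction hypothesis applies again.
    have h1 : y (k + 1) • F.d i w = - F.d i u := by
      have h0 := congrArg (F.d i) hw
      rw [F.d_d, map_add, map_smul, add_comm] at h0
      exact eq_neg_of_add_eq_zero_left h0.symm
    have h2 : F.d i w ∈ vecIdeal (initialIdeal y (k + 1)) _ :=
      hvec (k + 1) hk _ (by rw [h1]; exact Submodule.neg_mem _ (map_mem_vecIdeal _ hu))
    obtain ⟨p, q, hq, rfl⟩ := mem_boundaries.1 (ih (by omega) i (by omega) w h2)
    have h3 : F.d (i + 1) (v - y (k + 1) • p) ∈ vecIdeal (initialIdeal y (k + 1)) _ := by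
      have : F.d (i + 1) (v - y (k + 1) • p) = u + y (k + 1) • q := by
        rw [map_sub, map_smul, hw, smul_add]; abel
      rw [this]
      exact Submodule.add_mem _ hu (Submodule.smul_mem _ _ hq)
    obtain ⟨s, t, ht, hst⟩ := mem_boundaries.1 (ih (by omega) (i + 1) (by omega) _ h3)
    refine mem_boundaries.2 ⟨s, t + y (k + 1) • p, Submodule.add_mem _
      (vecIdeal_initialIdeal_mono y _ (by omega) ht) (smul_mem_vecIdeal y (by omega) p), ?_⟩
    rw [← add_assoc, ← hst]; abel

/-- A homogeneous socle element of `R/(I + (y₀))` of degree `e` gives, for every `k ≤ n`, a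
homogeneous element of `Fₖ` of degree `e + k` that represents a nonzero element of
`Fₖ / (im d + (y₀, …, yₖ) Fₖ)` killed by `(y₀, …, yₙ)`. -/
theorem exists_socle_representative
    (hreg : ∀ k ≤ n, ∀ f, y k * f ∈ initialIdeal y k → f ∈ initialIdeal y k)
    (hy : ∀ k ≤ n, (y k).IsHomogeneous 1)
    (hI : ∀ f, y 0 * f ∈ I → f ∈ I)
    (hIhom : ∀ p ∈ I, ∀ k, MvPolynomial.homogeneousComponent k p ∈ I)
    {f : MvPolynomial σ K} {e : ℤ} (hf : IsHomogeneousOfDegree f e)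
    (hfn : ∀ g, f - y 0 * g ∉ I) (hfs : ∀ i ≤ n, ∃ g, y i * f - y 0 * g ∈ I)
    {k : ℕ} (hk : k ≤ n) :
    ∃ v, IsHomogeneousVec (F.shift k) v (e + k) ∧ v ∉ F.boundaries y (k + 1) k ∧
      ∀ i ≤ n, y i • v ∈ F.boundaries y (k + 1) k := by
  have hhom : ∀ k ≤ n + 1, ∀ p ∈ initialIdeal y k, ∀ j,
      MvPolynomial.homogeneousComponent j p ∈ initialIdeal y k := by
    refine fun k hk => span_component_mem ?_
    rintro _ ⟨i, hi, rfl⟩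
    exact ⟨1, hy i (by have := Set.mem_Iio.1 hi; omega)⟩
  induction k with
  | zero =>
    obtain ⟨v, hv, hvf⟩ := F.exists_isHomogeneousVec_aug_eq hIhom hf
    refine ⟨v, by simpa using hv, fun hmem => ?_, fun i hi => ?_⟩
    · obtain ⟨p, q, hq, rfl⟩ := mem_boundaries.1 hmem
      obtain ⟨u, hu, w, rfl⟩ := exists_of_mem_vecIdeal_succ hq
      have hu0 : u = 0 := by
        ext1 j
        simpa [initialIdeal_zero] using mem_vecIdeal.1 hu j
      obtain ⟨g, hg⟩ := Ideal.Quotient.mk_surjective (F.aug w)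
      rw [hu0, zero_add (y 0 • w), map_add, (F.exact_zero _).2 ⟨p, rfl⟩, zero_add,
        F.aug_smul _ g w hg.symm] at hvf
      exact hfn g (Ideal.Quotient.eq.1 hvf.symm)
    · obtain ⟨g, hg⟩ := hfs i hi
      obtain ⟨w, hw⟩ := F.aug_surjective (Ideal.Quotient.mk I g)
      obtain ⟨p, hp⟩ := (F.exact_zero (y i • v - y 0 • w)).1 (by
        rw [map_sub, F.aug_smul _ _ _ hvf, F.aug_smul _ _ _ hw, sub_eq_zero]
        exact Ideal.Quotient.eq.2 hg)
      exact mem_boundaries.2 ⟨p, y 0 • w, smul_mem_vecIdeal y one_pos w, by rw [hp]; abel⟩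
  | succ k ih =>
    obtain ⟨v, hv, hvn, hvs⟩ := ih (by omega)
    -- The connecting map is inverted: as yₖ₊₁ kills the class of `v`, `yₖ₊₁ v = d w₀ + u₀`, and
    -- `w₀` is the next representative. Its component in the degree of `yₖ₊₁ v` makes it
    -- homogeneous.
    obtain ⟨w₀, u₀, hu₀, hw₀⟩ := mem_boundaries.1 (hvs (k + 1) hk)
    set w := vecComponent (F.shift (k + 1)) (e + k + 1) w₀ with hwdef
    set u := vecComponent (F.shift k) (e + k + 1) u₀ with hudef
    have hu : u ∈ vecIdeal (initialIdeal y (k + 1)) _ :=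
      vecComponent_mem (hhom _ (by omega)) _ _ hu₀
    have hw : y (k + 1) • v = F.d k w + u := by
      have := congrArg (vecComponent (F.shift k) (e + k + 1)) hw₀
      rwa [vecComponent_smul _ _ (hy _ hk), vecComponent_of_isHomogeneous hv, if_pos rfl, map_add,
        ← d_vecComponent] at this
    have hdw : F.d k w = y (k + 1) • v - u := by rw [hw]; abel
    refine ⟨w, ?_, fun hmem => ?_, fun i hi => ?_⟩
    · have := vecComponent_isHomogeneous (F.shift (k + 1)) (e + k + 1) w₀
      rw [Nat.cast_add, Nat.cast_one, ← add_assoc]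
      exact this
    -- If `w` were a boundary, cancelling yₖ₊₁ would place `v - d w'` in the shorter ideal, making
    -- `v` a boundary.
    · obtain ⟨p, q, hq, hpq⟩ := mem_boundaries.1 hmem
      obtain ⟨u', hu', w', rfl⟩ := exists_of_mem_vecIdeal_succ hq
      have h1 : y (k + 1) • (v - F.d k w') = F.d k u' + u := by
        have h2 : F.d k w = F.d k u' + y (k + 1) • F.d k w' := by
          rw [hpq, map_add, F.d_d, zero_add, map_add, map_smul]
        rw [smul_sub, hw, h2]; abel
      have h3 : v - F.d k w' ∈ vecIdeal (initialIdeal y (k + 1)) _ := by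
        refine mem_vecIdeal.2 fun j => hreg (k + 1) hk _ ?_
        have h4 := Submodule.add_mem _ (map_mem_vecIdeal (F.d k) hu') hu
        rw [← h1] at h4
        exact mem_vecIdeal.1 h4 j
      exact hvn (mem_boundaries.2 ⟨w', _, h3, by abel⟩)
    -- From `yᵢ v = d p + q`, the element `yᵢ w - yₖ₊₁ p` is a cycle modulo the shorter ideal, and
    -- there is no homology in degree `k + 1` at that stage.
    · obtain ⟨p, q, hq, hpq⟩ := mem_boundaries.1 (hvs i hi)
      have h1 : F.d k (y i • w - y (k + 1) • p) = y (k + 1) • q - y i • u := by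
        rw [map_sub, map_smul, map_smul, hdw, smul_sub, smul_comm (y i), hpq, smul_add]; abel
      have h2 := F.mem_boundaries_of_d_mem hreg hI (k := k) (by omega) k le_rfl
        (y i • w - y (k + 1) • p) (by
          rw [h1]
          exact Submodule.sub_mem _ (Submodule.smul_mem _ _ hq) (Submodule.smul_mem _ _ hu))
      obtain ⟨s, t, ht, hst⟩ := mem_boundaries.1 h2
      refine mem_boundaries.2 ⟨s, t + y (k + 1) • p, Submodule.add_mem _
        (vecIdeal_initialIdeal_mono y _ (by omega) ht) (smul_mem_vecIdeal y (by omega) p), ?_⟩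
      rw [← add_assoc, ← hst]; abel

theorem boundaries_le (k i : ℕ)
    (hJ : initialIdeal y k = Ideal.span (Set.range MvPolynomial.X)) :
    F.boundaries y k i ≤ vecIdeal (Ideal.span (Set.range MvPolynomial.X)) (F.rank i) := by
  refine sup_le ?_ (by rw [hJ])
  rintro _ ⟨v, rfl⟩
  exact mem_vecIdeal.2 fun j => F.minimal i v j

theorem one_notMem_span_X :
    (1 : MvPolynomial σ K) ∉ Ideal.span (Set.range (MvPolynomial.X : σ → MvPolynomial σ K)) := by
  intro h
  have h' : Ideal.span (Set.range (MvPolynomial.X : σ → MvPolynomial σ K)) ≤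
      RingHom.ker (MvPolynomial.constantCoeff (σ := σ) (R := K)) := by
    rw [Ideal.span_le]
    rintro _ ⟨i, rfl⟩
    simp
  simpa using h' h

/-- By minimality every vector of `Fᵢ` is a cycle modulo 𝔪. For i > n it is then a boundary modulo
𝔪, so it lies in `𝔪Fᵢ`, which fails for the all-ones vector unless the rank is zero. -/
theorem rank_eq_zero
    (hreg : ∀ k ≤ n, ∀ f, y k * f ∈ initialIdeal y k → f ∈ initialIdeal y k)
    (hI : ∀ f, y 0 * f ∈ I → f ∈ I)
    (hJ : initialIdeal y (n + 1) = Ideal.span (Set.range MvPolynomial.X)) {i : ℕ} (hi : n < i) :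
    F.rank i = 0 := by
  obtain ⟨i, rfl⟩ : ∃ j, i = j + 1 := ⟨i - 1, by omega⟩
  by_contra h
  have h1 := F.boundaries_le _ _ hJ (F.mem_boundaries_of_d_mem hreg hI le_rfl i (by omega) 1
    (by rw [hJ]; exact mem_vecIdeal.2 fun j => F.minimal i _ j))
  exact one_notMem_span_X (mem_vecIdeal.1 h1 ⟨0, Nat.pos_of_ne_zero h⟩)

theorem mem_span_X_of_isHomogeneous {p : MvPolynomial σ K} {k : ℕ} (hk : k ≠ 0)
    (hp : p.IsHomogeneous k) :
    p ∈ Ideal.span (Set.range (MvPolynomial.X : σ → MvPolynomial σ K)) := by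
  rw [← Set.image_univ, MvPolynomial.mem_ideal_span_X_image]
  intro m hm
  by_contra! h
  have h0 : m = 0 := Finsupp.ext fun i => h i trivial
  exact MvPolynomial.mem_support_iff.1 hm (hp.coeff_eq_zero (by simpa [h0] using hk.symm))

/-- The representative in `Fₙ` lies outside `𝔪Fₙ`, so one of its coordinates is outside 𝔪. Being
homogeneous, that coordinate has degree 0, which fixes the shift. -/
theorem exists_shift_eq
    (hreg : ∀ k ≤ n, ∀ f, y k * f ∈ initialIdeal y k → f ∈ initialIdeal y k)
    (hy : ∀ k ≤ n, (y k).IsHomogeneous 1)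
    (hI : ∀ f, y 0 * f ∈ I → f ∈ I)
    (hIhom : ∀ p ∈ I, ∀ k, MvPolynomial.homogeneousComponent k p ∈ I)
    (hJ : initialIdeal y (n + 1) = Ideal.span (Set.range MvPolynomial.X))
    {f : MvPolynomial σ K} {e : ℤ} (hf : IsHomogeneousOfDegree f e)
    (hfn : ∀ g, f - y 0 * g ∉ I) (hfs : ∀ i ≤ n, ∃ g, y i * f - y 0 * g ∈ I) :
    ∃ j, F.shift n j = e + n := by
  obtain ⟨v, hv, hvn, -⟩ :=
    F.exists_socle_representative hreg hy hI hIhom hf hfn hfs (le_refl n)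
  have h1 : v ∉ vecIdeal (initialIdeal y (n + 1)) _ := fun h => hvn (Submodule.mem_sup_right h)
  rw [hJ, mem_vecIdeal] at h1
  push Not at h1
  obtain ⟨j, hj⟩ := h1
  refine ⟨j, ?_⟩
  rcases hv j with h0 | ⟨k, hk, hkh⟩
  · exact absurd (h0 ▸ Submodule.zero_mem _) hj
  · rcases eq_or_ne k 0 with rfl | hk0
    · push_cast at hk; omega
    · exact absurd (mem_span_X_of_isHomogeneous hk0 hkh) hj

end MinimalGradedFreeResolution

/-! ### The regular sequence ℓ, X₁, …, Xₙ. -/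

section LinearForms

variable {K : Type*} [Field K] {n : ℕ}

/-- The linear form of a functional, as a polynomial. -/
noncomputable def linearForm (φ : Module.Dual K (Fin (n + 1) → K)) :
    MvPolynomial (Fin (n + 1)) K :=
  ∑ i, MvPolynomial.C (φ (Pi.single i 1)) * MvPolynomial.X i

theorem linearForm_isHomogeneous (φ : Module.Dual K (Fin (n + 1) → K)) :
    (linearForm φ).IsHomogeneous 1 :=
  MvPolynomial.IsHomogeneous.sum _ _ _ fun i _ => MvPolynomial.isHomogeneous_C_mul_X _ i

theorem eval_linearForm (φ : Module.Dual K (Fin (n + 1) → K)) (v : Fin (n + 1) → K) :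
    MvPolynomial.eval v (linearForm φ) = φ v := by
  rw [LinearMap.pi_apply_eq_sum_univ φ v]
  simp only [linearForm, map_sum, map_mul, MvPolynomial.eval_C, MvPolynomial.eval_X, smul_eq_mul]
  refine Finset.sum_congr rfl fun i _ => ?_
  rw [mul_comm]
  congr 2
  ext j
  rcases eq_or_ne i j with rfl | h
  · simp
  · simp [h, h.symm]

theorem linearForm_proj (i : Fin (n + 1)) :
    linearForm (LinearMap.proj i : Module.Dual K (Fin (n + 1) → K)) = MvPolynomial.X i := by
  rw [linearForm, Finset.sum_eq_single i]
  · simp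
  · intro j _ hj
    simp [hj.symm]
  · exact fun h => absurd (Finset.mem_univ i) h

/-- The sequence `ℓ, X₁, …, Xₙ`. -/
noncomputable def linearSequence (φ : Module.Dual K (Fin (n + 1) → K)) (i : ℕ) :
    MvPolynomial (Fin (n + 1)) K :=
  if i = 0 then linearForm φ else if h : i < n + 1 then MvPolynomial.X ⟨i, h⟩ else 0

theorem linearSequence_zero (φ : Module.Dual K (Fin (n + 1) → K)) :
    linearSequence φ 0 = linearForm φ := rfl

theorem linearSequence_of_ne_zero (φ : Module.Dual K (Fin (n + 1) → K)) {i : Fin (n + 1)}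
    (hi : i ≠ 0) : linearSequence φ i = MvPolynomial.X i := by
  rw [linearSequence, if_neg (Fin.val_ne_zero_iff.2 hi), dif_pos i.2]

theorem exists_linearSequence_eq_linearForm (φ : Module.Dual K (Fin (n + 1) → K)) {i : ℕ}
    (hi : i ≤ n) : ∃ ψ, linearSequence φ i = linearForm ψ := by
  rcases eq_or_ne i 0 with rfl | h
  · exact ⟨φ, rfl⟩
  · exact ⟨LinearMap.proj ⟨i, Nat.lt_succ_of_le hi⟩, by
      rw [linearForm_proj, linearSequence, if_neg h, dif_pos (Nat.lt_succ_of_le hi)]⟩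

theorem linearSequence_isHomogeneous (φ : Module.Dual K (Fin (n + 1) → K)) (i : ℕ) :
    (linearSequence φ i).IsHomogeneous 1 := by
  unfold linearSequence
  split_ifs
  · exact linearForm_isHomogeneous φ
  · exact MvPolynomial.isHomogeneous_X _ _
  · exact MvPolynomial.isHomogeneous_zero _ _ _

theorem linearForm_ne_zero {φ : Module.Dual K (Fin (n + 1) → K)} {v : Fin (n + 1) → K}
    (h : φ v ≠ 0) : linearForm φ ≠ 0 := by
  intro h0
  rw [← eval_linearForm, h0, map_zero] at h
  exact h rfl

/-- The substitution with kernel `(ℓ, X₁, …, Xₖ)`: it sends `X₁, …, Xₖ` to `0` and solves `ℓ = 0`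
for `X₀`. -/
noncomputable def eliminate (φ : Module.Dual K (Fin (n + 1) → K)) (k : ℕ) :
    MvPolynomial (Fin (n + 1)) K →ₐ[K] MvPolynomial (Fin (n + 1)) K :=
  MvPolynomial.aeval fun i => if i = 0 then
      MvPolynomial.C (-(φ (Pi.single 0 1))⁻¹) * ∑ j : Fin (n + 1) with k < j.1,
        MvPolynomial.C (φ (Pi.single j 1)) * MvPolynomial.X j
    else if k < i.1 then MvPolynomial.X i else 0

theorem eliminate_X_zero (φ : Module.Dual K (Fin (n + 1) → K)) (k : ℕ) :
    eliminate φ k (MvPolynomial.X 0) =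
      MvPolynomial.C (-(φ (Pi.single 0 1))⁻¹) * ∑ j : Fin (n + 1) with k < j.1,
        MvPolynomial.C (φ (Pi.single j 1)) * MvPolynomial.X j := by
  simp [eliminate]

theorem eliminate_X_of_ne_zero (φ : Module.Dual K (Fin (n + 1) → K)) (k : ℕ) {i : Fin (n + 1)}
    (hi : i ≠ 0) :
    eliminate φ k (MvPolynomial.X i) = if k < i.1 then MvPolynomial.X i else 0 := by
  simp [eliminate, hi]

theorem linearForm_eq_add_sum (φ : Module.Dual K (Fin (n + 1) → K)) :
    linearForm φ = MvPolynomial.C (φ (Pi.single 0 1)) * MvPolynomial.X 0 +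
      ∑ j : Fin n, MvPolynomial.C (φ (Pi.single j.succ 1)) * MvPolynomial.X j.succ :=
  Fin.sum_univ_succ _

theorem sum_filter_lt_eq (k : ℕ) (g : Fin (n + 1) → MvPolynomial (Fin (n + 1)) K) :
    ∑ j : Fin (n + 1) with k < j.1, g j = ∑ j : Fin n, if k < j.1 + 1 then g j.succ else 0 := by
  rw [Finset.sum_filter, Fin.sum_univ_succ]
  simp

theorem eliminate_linearForm {φ : Module.Dual K (Fin (n + 1) → K)}
    (h0 : φ (Pi.single 0 1) ≠ 0) (k : ℕ) : eliminate φ k (linearForm φ) = 0 := by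
  have hC : (MvPolynomial.C (φ (Pi.single 0 1)) * MvPolynomial.C (-(φ (Pi.single 0 1))⁻¹) :
      MvPolynomial (Fin (n + 1)) K) = -1 := by
    rw [← map_mul, mul_neg, mul_inv_cancel₀ h0, map_neg, map_one]
  rw [linearForm_eq_add_sum, map_add, map_mul, map_sum, eliminate_X_zero, sum_filter_lt_eq]
  simp only [map_mul, MvPolynomial.algHom_C, MvPolynomial.algebraMap_eq,
    eliminate_X_of_ne_zero φ k (Fin.succ_ne_zero _), Fin.val_succ, mul_ite, mul_zero]
  rw [← mul_assoc, hC]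
  ring

theorem initialIdeal_le_ker_eliminate {φ : Module.Dual K (Fin (n + 1) → K)}
    (h0 : φ (Pi.single 0 1) ≠ 0) (k : ℕ) :
    initialIdeal (linearSequence φ) (k + 1) ≤ RingHom.ker (eliminate φ k) := by
  rw [initialIdeal, Ideal.span_le]
  rintro _ ⟨i, hi, rfl⟩
  rw [SetLike.mem_coe, RingHom.mem_ker]
  have hi' : i < k + 1 := hi
  unfold linearSequence
  split_ifs with h1 h2
  · exact eliminate_linearForm h0 k
  · rw [eliminate_X_of_ne_zero φ k (by simpa [Fin.ext_iff] using h1), if_neg (by simp; omega)]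
  · exact map_zero _

/-- The substitution is the identity modulo the ideal, which only has to be checked on the
variables. With `initialIdeal_le_ker_eliminate`, this identifies the ideal as the kernel. -/
theorem sub_eliminate_mem {φ : Module.Dual K (Fin (n + 1) → K)}
    (h0 : φ (Pi.single 0 1) ≠ 0) (k : ℕ) (f : MvPolynomial (Fin (n + 1)) K) :
    f - eliminate φ k f ∈ initialIdeal (linearSequence φ) (k + 1) := by
  have hX : ∀ i : Fin (n + 1), i ≠ 0 → ¬ k < i.1 →
      MvPolynomial.X i ∈ initialIdeal (linearSequence φ) (k + 1) := by
    intro i hi hk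
    rw [← linearSequence_of_ne_zero φ hi]
    exact mem_initialIdeal _ (by omega)
  induction f using MvPolynomial.induction_on with
  | C a => simp [MvPolynomial.algHom_C]
  | add p q hp hq =>
    rw [map_add, add_sub_add_comm]
    exact Ideal.add_mem _ hp hq
  | mul_X p i hp =>
    suffices h : MvPolynomial.X i - eliminate φ k (MvPolynomial.X i) ∈
        initialIdeal (linearSequence φ) (k + 1) by
      have : p * MvPolynomial.X i - eliminate φ k (p * MvPolynomial.X i) =
          MvPolynomial.X i * (p - eliminate φ k p) +
          eliminate φ k p * (MvPolynomial.X i - eliminate φ k (MvPolynomial.X i)) := by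
        rw [map_mul]; ring
      rw [this]
      exact Ideal.add_mem _ (Ideal.mul_mem_left _ _ hp) (Ideal.mul_mem_left _ _ h)
    rcases eq_or_ne i 0 with rfl | hi
    · have hC : (MvPolynomial.C (φ (Pi.single 0 1))⁻¹ * MvPolynomial.C (φ (Pi.single 0 1)) :
          MvPolynomial (Fin (n + 1)) K) = 1 := by
        rw [← map_mul, inv_mul_cancel₀ h0, map_one]
      -- Solving ℓ = 0 for X₀ leaves as error a multiple of ℓ minus its terms in X₁, …, Xₖ, all of
      -- them in the ideal.
      have h1 : MvPolynomial.X 0 - eliminate φ k (MvPolynomial.X 0) =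
          MvPolynomial.C (φ (Pi.single 0 1))⁻¹ * (linearForm φ -
            ∑ j : Fin n, if k < j.1 + 1 then 0 else
              MvPolynomial.C (φ (Pi.single j.succ 1)) * MvPolynomial.X j.succ) := by
        have h2 : ∑ j : Fin n, MvPolynomial.C (φ (Pi.single j.succ 1)) *
              (MvPolynomial.X j.succ : MvPolynomial (Fin (n + 1)) K) =
            (∑ j : Fin n, if k < j.1 + 1 then
              MvPolynomial.C (φ (Pi.single j.succ 1)) * MvPolynomial.X j.succ else 0) +
            ∑ j : Fin n, if k < j.1 + 1 then 0 else
              MvPolynomial.C (φ (Pi.single j.succ 1)) * MvPolynomial.X j.succ := by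
          rw [← Finset.sum_add_distrib]
          refine Finset.sum_congr rfl fun j _ => ?_
          split_ifs <;> simp
        rw [eliminate_X_zero, sum_filter_lt_eq, linearForm_eq_add_sum, h2, map_neg]
        linear_combination -(MvPolynomial.X 0) * hC
      rw [h1]
      refine Ideal.mul_mem_left _ _ (Ideal.sub_mem _ ?_ (Ideal.sum_mem _ fun j _ => ?_))
      · rw [← linearSequence_zero]
        exact mem_initialIdeal _ k.succ_pos
      · split_ifs with h
        · exact Ideal.zero_mem _
        · exact Ideal.mul_mem_left _ _ (hX _ (Fin.succ_ne_zero j) h)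
    · rw [eliminate_X_of_ne_zero φ k hi]
      split_ifs with h
      · simp
      · rw [sub_zero]
        exact hX i hi h

/-- For positive index the ideal is the kernel of a map to a domain that fixes the next variable, so
that variable cancels modulo the ideal. -/
theorem linearSequence_regular {φ : Module.Dual K (Fin (n + 1) → K)}
    (h0 : φ (Pi.single 0 1) ≠ 0) {k : ℕ} (hk : k ≤ n) (f : MvPolynomial (Fin (n + 1)) K)
    (hf : linearSequence φ k * f ∈ initialIdeal (linearSequence φ) k) :
    f ∈ initialIdeal (linearSequence φ) k := by
  cases k with
  | zero =>
    rw [initialIdeal_zero, Ideal.mem_bot] at hf ⊢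
    exact (mul_eq_zero.1 hf).resolve_left (linearForm_ne_zero h0)
  | succ k =>
    have h1 := initialIdeal_le_ker_eliminate h0 k hf
    have hne : (⟨k + 1, by omega⟩ : Fin (n + 1)) ≠ 0 := by simp [Fin.ext_iff]
    rw [RingHom.mem_ker, map_mul, linearSequence_of_ne_zero φ hne,
      eliminate_X_of_ne_zero φ k hne, if_pos (by simp)] at h1
    have h2 := (mul_eq_zero.1 h1).resolve_left (MvPolynomial.X_ne_zero _)
    simpa [h2] using sub_eliminate_mem h0 k f

theorem initialIdeal_linearSequence {φ : Module.Dual K (Fin (n + 1) → K)}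
    (h0 : φ (Pi.single 0 1) ≠ 0) :
    initialIdeal (linearSequence φ) (n + 1) = Ideal.span (Set.range MvPolynomial.X) := by
  apply le_antisymm
  · rw [initialIdeal, Ideal.span_le]
    rintro _ ⟨i, -, rfl⟩
    exact MinimalGradedFreeResolution.mem_span_X_of_isHomogeneous one_ne_zero
      (linearSequence_isHomogeneous φ i)
  · rw [Ideal.span_le]
    rintro _ ⟨i, rfl⟩
    have h1 : eliminate φ n (MvPolynomial.X i) = 0 := by
      rcases eq_or_ne i 0 with rfl | hi
      · rw [eliminate_X_zero, Finset.sum_eq_zero, mul_zero]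
        intro j hj
        have := (Finset.mem_filter.1 hj).2
        omega
      · rw [eliminate_X_of_ne_zero φ n hi, if_neg (by omega)]
    have h2 := sub_eliminate_mem h0 n (MvPolynomial.X i)
    rwa [h1, sub_zero] at h2

end LinearForms

/-! ### Separators of points and the minimum distance. -/

section Points

variable {K : Type*} [Field K] {n : ℕ} {Γ : Finset (ℙ K (Fin (n + 1) → K))}

theorem component_mem_pointsIdeal :
    ∀ p ∈ pointsIdeal Γ, ∀ k, MvPolynomial.homogeneousComponent k p ∈ pointsIdeal Γ :=
  span_component_mem fun _ hf => hf.1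

theorem eval_eq_zero_of_mem_pointsIdeal {f : MvPolynomial (Fin (n + 1)) K}
    (hf : f ∈ pointsIdeal Γ) {P : ℙ K (Fin (n + 1) → K)} (hP : P ∈ Γ) :
    MvPolynomial.eval P.rep f = 0 := by
  have h : pointsIdeal Γ ≤ RingHom.ker (MvPolynomial.eval P.rep) := by
    rw [pointsIdeal, Ideal.span_le]
    exact fun g hg => hg.2 P hP
  exact h hf

theorem mem_pointsIdeal_of_isHomogeneous {f : MvPolynomial (Fin (n + 1)) K} {k : ℕ}
    (hf : f.IsHomogeneous k) (h : ∀ P ∈ Γ, MvPolynomial.eval P.rep f = 0) : f ∈ pointsIdeal Γ :=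
  Ideal.subset_span ⟨⟨k, hf⟩, h⟩

theorem homogeneousComponent_succ_mul {σ : Type*} {y : MvPolynomial σ K}
    (hy : y.IsHomogeneous 1) (k : ℕ) (p : MvPolynomial σ K) :
    MvPolynomial.homogeneousComponent (k + 1) (y * p) =
      y * MvPolynomial.homogeneousComponent k p := by
  rw [← intComponent_natCast, ← intComponent_natCast, Nat.cast_succ, intComponent_mul hy]

/-- A linear form that vanishes at no point of `Γ` is regular on `R/I(Γ)`. -/
theorem mem_pointsIdeal_of_linearForm_mul_mem {φ : Module.Dual K (Fin (n + 1) → K)}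
    (hφ : ∀ P ∈ Γ, φ P.rep ≠ 0) {f : MvPolynomial (Fin (n + 1)) K}
    (hf : linearForm φ * f ∈ pointsIdeal Γ) : f ∈ pointsIdeal Γ := by
  rw [← MvPolynomial.sum_homogeneousComponent f]
  -- Vanishing at the chosen representatives implies membership only for forms, hence the passage to
  -- homogeneous components.
  refine Ideal.sum_mem _ fun k _ => ?_
  refine mem_pointsIdeal_of_isHomogeneous
    (MvPolynomial.homogeneousComponent_isHomogeneous k f) fun P hP => ?_
  have h1 := component_mem_pointsIdeal _ hf (k + 1)
  rw [homogeneousComponent_succ_mul (linearForm_isHomogeneous φ)] at h1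
  have h2 := eval_eq_zero_of_mem_pointsIdeal h1 hP
  rw [map_mul, eval_linearForm] at h2
  exact (mul_eq_zero.1 h2).resolve_left (hφ P hP)

/-- `f` is a form of degree `k` that vanishes at the points of `Γ` other than `P`, but not at
`P`. -/
def IsSeparator (Γ : Finset (ℙ K (Fin (n + 1) → K))) (P : ℙ K (Fin (n + 1) → K)) (k : ℕ)
    (f : MvPolynomial (Fin (n + 1)) K) : Prop :=
  f.IsHomogeneous k ∧ MvPolynomial.eval P.rep f ≠ 0 ∧
    ∀ Q ∈ Γ, Q ≠ P → MvPolynomial.eval Q.rep f = 0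

variable {P : ℙ K (Fin (n + 1) → K)} {k : ℕ} {f : MvPolynomial (Fin (n + 1)) K}

/-- Both products vanish on Γ away from P, so the scalar matching their values at P makes the
difference vanish on all of Γ. -/
theorem exists_linearForm_mul_sub_mem (hf : IsSeparator Γ P k f)
    {φ ψ : Module.Dual K (Fin (n + 1) → K)} (hφ : φ P.rep ≠ 0) :
    ∃ g, linearForm ψ * f - linearForm φ * g ∈ pointsIdeal Γ := by
  have hdeg : ∀ χ : Module.Dual K (Fin (n + 1) → K), (linearForm χ * f).IsHomogeneous (1 + k) :=
    fun χ => (linearForm_isHomogeneous χ).mul hf.1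
  refine ⟨MvPolynomial.C (ψ P.rep / φ P.rep) * f, ?_⟩
  rw [mul_left_comm]
  refine mem_pointsIdeal_of_isHomogeneous ((hdeg ψ).sub ((hdeg φ).C_mul _)) fun Q hQ => ?_
  simp only [map_sub, map_mul, MvPolynomial.eval_C, eval_linearForm]
  rcases eq_or_ne Q P with rfl | h
  · field_simp
    ring
  · simp [hf.2.2 Q hQ h]

/-- If f ≡ ℓg modulo I, then since ℓ vanishes nowhere on Γ, the component of g one degree below f
would be a separator of smaller degree. In degree 0, ℓg contributes nothing and f would vanish at P.
-/
theorem sub_linearForm_mul_notMem (hP : P ∈ Γ) (hf : IsSeparator Γ P k f)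
    (hmin : ∀ j < k, ∀ g, ¬ IsSeparator Γ P j g) {φ : Module.Dual K (Fin (n + 1) → K)}
    (hφ : ∀ Q ∈ Γ, φ Q.rep ≠ 0) (g : MvPolynomial (Fin (n + 1)) K) :
    f - linearForm φ * g ∉ pointsIdeal Γ := by
  intro h
  have h1 := component_mem_pointsIdeal _ h k
  rw [map_sub, MvPolynomial.homogeneousComponent_eq_self hf.1] at h1
  cases k with
  | zero =>
    have h2 : MvPolynomial.homogeneousComponent 0 (linearForm φ * g) = 0 := by
      rw [MvPolynomial.homogeneousComponent_zero, ← MvPolynomial.constantCoeff_eq, map_mul,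
        MvPolynomial.constantCoeff_eq,
        (linearForm_isHomogeneous φ).coeff_eq_zero (by simp), zero_mul, map_zero]
    rw [h2, sub_zero] at h1
    exact hf.2.1 (eval_eq_zero_of_mem_pointsIdeal h1 hP)
  | succ k =>
    rw [homogeneousComponent_succ_mul (linearForm_isHomogeneous φ)] at h1
    have h2 : ∀ Q ∈ Γ, MvPolynomial.eval Q.rep f =
        φ Q.rep * MvPolynomial.eval Q.rep (MvPolynomial.homogeneousComponent k g) := by
      intro Q hQ
      have := eval_eq_zero_of_mem_pointsIdeal h1 hQ
      rwa [map_sub, map_mul, eval_linearForm, sub_eq_zero] at this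
    refine hmin k k.lt_succ_self _
      ⟨MvPolynomial.homogeneousComponent_isHomogeneous k g, fun h0 => ?_, fun Q hQ hne => ?_⟩
    · exact hf.2.1 (by rw [h2 P hP, h0, mul_zero])
    · have h3 := h2 Q hQ
      rw [hf.2.2 Q hQ hne, eq_comm] at h3
      exact (mul_eq_zero.1 h3).resolve_left (hφ Q hQ)

theorem exists_dual_apply_eq_zero {Q : ℙ K (Fin (n + 1) → K)} (h : Q ≠ P) :
    ∃ φ : Module.Dual K (Fin (n + 1) → K), φ Q.rep = 0 ∧ φ P.rep ≠ 0 := by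
  have hP : P.rep ∉ Submodule.span K {Q.rep} := by
    rw [Submodule.mem_span_singleton]
    rintro ⟨a, ha⟩
    apply h
    rw [← P.mk_rep, ← Q.mk_rep, eq_comm, Projectivization.mk_eq_mk_iff']
    exact ⟨a, ha⟩
  obtain ⟨φ, h1, h2⟩ := Submodule.exists_dual_map_eq_bot_of_notMem hP inferInstance
  refine ⟨φ, ?_, h1⟩
  have h3 : φ Q.rep ∈ (Submodule.span K {Q.rep}).map φ :=
    ⟨_, Submodule.mem_span_singleton_self _, rfl⟩
  rwa [h2, Submodule.mem_bot] at h3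

/-- A point outside a hyperplane has a separator of degree the number of points outside it. -/
theorem exists_isSeparator [DecidableEq K] {φ : Module.Dual K (Fin (n + 1) → K)} (hP : P ∈ Γ)
    (hφ : φ P.rep ≠ 0) :
    ∃ f, IsSeparator Γ P (Γ.filter fun Q => φ Q.rep ≠ 0).card f := by
  classical
  choose! ψ hψ0 hψP using fun Q (h : Q ≠ P) => exists_dual_apply_eq_zero h
  set S := Γ.filter fun Q => φ Q.rep ≠ 0
  have hPS : P ∈ S := Finset.mem_filter.2 ⟨hP, hφ⟩
  -- The factor φ kills all points on the hyperplane at once; each other point of `S` costs one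
  -- factor. The degree is 1 + (|S| - 1).
  refine ⟨linearForm φ * ∏ Q ∈ S.erase P, linearForm (ψ Q), ?_, ?_, fun Q hQ hne => ?_⟩
  · have h1 := (linearForm_isHomogeneous φ).mul (MvPolynomial.IsHomogeneous.prod (S.erase P)
      (fun Q => linearForm (ψ Q)) (fun _ => 1) fun Q _ => linearForm_isHomogeneous (ψ Q))
    have h2 : 1 + ∑ Q ∈ S.erase P, 1 = S.card := by
      rw [Finset.sum_const, smul_eq_mul, mul_one, add_comm, Finset.card_erase_add_one hPS]
    rwa [h2] at h1
  · rw [map_mul, map_prod, eval_linearForm]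
    refine mul_ne_zero hφ (Finset.prod_ne_zero_iff.2 fun Q hQ => ?_)
    rw [eval_linearForm]
    exact hψP Q (Finset.ne_of_mem_erase hQ)
  · rw [map_mul, map_prod, eval_linearForm]
    by_cases h : φ Q.rep = 0
    · rw [h, zero_mul]
    · rw [Finset.prod_eq_zero (i := Q), mul_zero]
      · exact Finset.mem_erase.2 ⟨hne, Finset.mem_filter.2 ⟨hQ, h⟩⟩
      · rw [eval_linearForm, hψ0 Q hne]

theorem minDist_eq_card [DecidableEq K] {φ : Module.Dual K (Fin (n + 1) → K)}
    (h : hyp Γ = (onHyperplane Γ φ).ncard) :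
    minDist Γ = ((Γ.filter fun Q => φ Q.rep ≠ 0).card : ℤ) := by
  have h1 : onHyperplane Γ φ = ((Γ.filter fun Q => φ Q.rep = 0 : Finset _) : Set _) := by
    ext Q
    simp [onHyperplane]
  have h2 := Finset.card_filter_add_card_filter_not (s := Γ) (fun Q => φ Q.rep = 0)
  rw [minDist, h, h1, Set.ncard_coe_finset, ← h2]
  push_cast
  ring

/-- Over an infinite field some functional avoids finitely many nonzero vectors. The first basis
vector is included so that X₀ can be eliminated. -/
theorem exists_dual_forall_ne_zero [Infinite K] (Γ : Finset (ℙ K (Fin (n + 1) → K))) :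
    ∃ φ : Module.Dual K (Fin (n + 1) → K), φ (Pi.single 0 1) ≠ 0 ∧ ∀ P ∈ Γ, φ P.rep ≠ 0 := by
  obtain ⟨φ, hφ⟩ := Module.exists_dual_forall_apply_ne_zero (K := K)
    (fun i : Option Γ => i.elim (Pi.single 0 1 : Fin (n + 1) → K) fun P => P.1.rep) (by
      rintro (_ | P)
      · simp
      · exact P.1.rep_nonzero)
  exact ⟨φ, hφ none, fun P hP => hφ (some ⟨P, hP⟩)⟩

end Points

/-! ### The inequality. -/

theorem theorem2p4 {K : Type*} [Field K] [CharZero K] {n : ℕ} (hn : 2 ≤ n)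
    (Γ : Finset (ℙ K (Fin (n + 1) → K))) (hΓ : IsNondegenerate Γ)
    (F : MinimalGradedFreeResolution (pointsIdeal Γ)) :
    (∀ i, n < i → F.rank i = 0) ∧
      ∃ A : ℤ, IsLeast (Set.range fun j : Fin (F.rank n) => F.shift n j - (n : ℤ)) A ∧
        A ≤ minDist Γ := by
  classical
  obtain ⟨ℓ, h0, hℓ⟩ := exists_dual_forall_ne_zero Γ
  have hreg : ∀ k ≤ n, ∀ f, linearSequence ℓ k * f ∈ initialIdeal (linearSequence ℓ) k →
      f ∈ initialIdeal (linearSequence ℓ) k := fun k hk => linearSequence_regular h0 hk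
  have hI : ∀ f, linearSequence ℓ 0 * f ∈ pointsIdeal Γ → f ∈ pointsIdeal Γ :=
    fun f hf => mem_pointsIdeal_of_linearForm_mul_mem hℓ hf
  have hJ := initialIdeal_linearSequence h0
  refine ⟨fun i hi => F.rank_eq_zero hreg hI hJ hi, ?_⟩
  obtain ⟨φ, hφ, hhyp⟩ := (hyp_isGreatest Γ).1
  obtain ⟨P, hP, hφP⟩ := hΓ φ hφ
  have hsep : ∃ k f, IsSeparator Γ P k f := ⟨_, exists_isSeparator hP hφP⟩
  -- A separator of P of least degree is the socle element modulo ℓ; the hyperplane attaining `hyp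
  -- Γ` bounds its degree.
  obtain ⟨f, hf⟩ := Nat.find_spec hsep
  have hle : Nat.find hsep ≤ (Γ.filter fun Q => φ Q.rep ≠ 0).card :=
    Nat.find_min' hsep (exists_isSeparator hP hφP)
  obtain ⟨j, hj⟩ := F.exists_shift_eq hreg (fun k _ => linearSequence_isHomogeneous ℓ k) hI
    component_mem_pointsIdeal hJ (Or.inr ⟨_, rfl, hf.1⟩)
    (sub_linearForm_mul_notMem hP hf
      (fun j hj g hg => Nat.find_min hsep hj ⟨g, hg⟩) hℓ)
    (fun i hi => by
      obtain ⟨ψ, hψ⟩ := exists_linearSequence_eq_linearForm ℓ hi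
      rw [hψ]
      exact exists_linearForm_mul_sub_mem hf (hℓ P hP))
  set s := Finset.univ.image fun j : Fin (F.rank n) => F.shift n j - (n : ℤ) with hs
  have hmem : (Nat.find hsep : ℤ) ∈ s :=
    Finset.mem_image.2 ⟨j, Finset.mem_univ j, by rw [hj]; ring⟩
  have hcoe : (s : Set ℤ) = Set.range fun j : Fin (F.rank n) => F.shift n j - (n : ℤ) := by
    simp [hs]
  refine ⟨s.min' ⟨_, hmem⟩, hcoe ▸ s.isLeast_min' _, (s.min'_le _ hmem).trans ?_⟩
  rw [minDist_eq_card hhyp]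
  exact_mod_cast hle
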